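/- Let $\mathbb K$ be a field of characteristic zero. For a $\mathbb K$-vector space $V$ and a linear map $f:V\to V$, let $T(V,f)$ be the tensor algebra $T(V)$ (the span of words with letters in $V$, with empty word $\emptyset$), equipped with the shuffle product $\shuffle$ (bilinear, with unit $\emptyset$, and $xu\shuffle yv=x(u\shuffle yv)+y(xu\shuffle v)$ for $x,y\in V$, $u,v\in T(V)$) and with the bilinear product $\bullet$ defined by $$\emptyset\bullet w'=0,\qquad xw\bullet w'=x(w\bullet w')+f(x)(w\shuffle w')\qquad (x\in V,\ w,w'\in T(V)).$$ A subset $S\subseteq T(V)$ generates $T(V,f)$ as a pre-Lie algebra if $T(V)$ is the only linear subspace containing $S$ and stable under $\bullet$; it generates $T(V,f)$ as a Com-Pre-Lie algebra if $T(V)$ is the only linear subspace containing $S$ and stable under both $\shuffle$ and $\bullet$ (subalgebras are not required to contain $\emptyset$). A generating set is minimal if no proper subset of it is generating. A word over a totally ordered alphabet is Lyndon if it is nonempty and lexicographically strictly smaller than each of its proper nonempty suffixes. (A) Let $D$ be a totally ordered set, let $V_D$ be the vector space with basis the biletters $\binom{k}{d}$, $k\in\mathbb N=\{0,1,2,\ldots\}$,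 $d\in D$, and let $f_D:V_D\to V_D$ be the linear map with $f_D\binom{k}{d}=\binom{k+1}{d}$; order the biletters $\binom{0}{d}$ as $D$. 1. The set of all words (including $\emptyset$) in the biletters $\binom{0}{d}$, $d\in D$, is a minimal generating set of the pre-Lie algebra $T(V_D,f_D)$. 2. The set consisting of $\emptyset$ and the Lyndon words in the biletters $\binom{0}{d}$, $d\in D$, is a minimal generating set of the Com-Pre-Lie algebra $T(V_D,f_D)$. (B) Let $V$ be a $\mathbb K$-vector space, $g:V\to V$ a linear map and $W\subseteq V$ a linear subspace such that $V=\sum_{n=0}^{\infty}g^n(W)$. 1. $T(V,g)$ is generated, as a pre-Lie algebra, by $T(W)\subseteq T(V)$. 2. For every basis $(w_d)_{d\in D}$ of $W$ indexed by a totally ordered set $D$, $T(V,g)$ is generated, as a Com-Pre-Lie algebra, by $\emptyset$ and the Lyndon words in the letters $w_d$, $d\in D$. -/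

import Mathlib

open scoped TensorProduct

noncomputable section

namespace ComPreLie

section Products

variable {K : Type*} [Field K] {V : Type*} [AddCommGroup V] [Module K V]

/-- Left multiplication by the letter `y` on pairs (word, deconcatenation of that word):
`(v, δ) ↦ (yv, ∅ ⊗ yv + (y ⊗ ∅) δ)`. -/
def deconcStep : V →ₗ[K] Module.End K
    (TensorAlgebra K V × (TensorAlgebra K V ⊗[K] TensorAlgebra K V)) where
  toFun y :=
    { toFun := fun p =>
        (TensorAlgebra.ι K y * p.1,
          (1 : TensorAlgebra K V) ⊗ₜ[K] (TensorAlgebra.ι K y * p.1) +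
            (TensorAlgebra.ι K y ⊗ₜ[K] (1 : TensorAlgebra K V)) * p.2)
      map_add' := fun p q => by
        ext <;> simp [mul_add, TensorProduct.tmul_add]
        abel
      map_smul' := fun c p => by
        ext <;> simp }
  map_add' x y := by
    refine LinearMap.ext fun p => ?_
    ext <;> simp [add_mul, TensorProduct.tmul_add, TensorProduct.add_tmul]
    abel
  map_smul' c y := by
    refine LinearMap.ext fun p => ?_
    ext <;> simp [← TensorProduct.smul_tmul']

/-- The deconcatenation coproduct of `T(V)`:
`x₁…xₙ ↦ ∑ᵢ x₁…xᵢ ⊗ xᵢ₊₁…xₙ`, the sum being over `0 ≤ i ≤ n`. -/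
def deconc : TensorAlgebra K V →ₗ[K] TensorAlgebra K V ⊗[K] TensorAlgebra K V :=
  LinearMap.snd K _ _ ∘ₗ LinearMap.applyₗ (1, 1 ⊗ₜ[K] 1) ∘ₗ
    (TensorAlgebra.lift K (deconcStep (K := K) (V := V))).toLinearMap

/-- The operator sending `u ⧢ ·` to `xu ⧢ ·`, through
`xu ⧢ b = ∑ b' x (u ⧢ b'')`, the sum being over all factorizations `b = b'b''`. -/
def shuffleStep : V →ₗ[K] Module.End K (TensorAlgebra K V →ₗ[K] TensorAlgebra K V) where
  toFun x :=
    { toFun := fun s =>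
        LinearMap.mul' K (TensorAlgebra K V) ∘ₗ
          LinearMap.lTensor _ (LinearMap.mulLeft K (TensorAlgebra.ι K x) ∘ₗ s) ∘ₗ deconc
      map_add' := fun s t => by
        simp [LinearMap.comp_add, LinearMap.add_comp]
      map_smul' := fun c s => by
        simp [LinearMap.comp_smul, LinearMap.smul_comp] }
  map_add' x y := by
    refine LinearMap.ext fun s => ?_
    have h : LinearMap.mulLeft K (TensorAlgebra.ι K (x + y)) =
      LinearMap.mulLeft K (TensorAlgebra.ι K x) + LinearMap.mulLeft K (TensorAlgebra.ι K y) := by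
        ext; simp [add_mul]
    simp only [LinearMap.coe_mk, AddHom.coe_mk, LinearMap.add_apply, h, LinearMap.comp_add,
      LinearMap.add_comp, LinearMap.lTensor_add]
  map_smul' c x := by
    refine LinearMap.ext fun s => ?_
    have h : LinearMap.mulLeft K (TensorAlgebra.ι K (c • x)) =
      c • LinearMap.mulLeft K (TensorAlgebra.ι K x) := by
        ext; simp
    simp only [LinearMap.coe_mk, AddHom.coe_mk, LinearMap.smul_apply, h, LinearMap.comp_smul,
      LinearMap.smul_comp, LinearMap.lTensor_smul, RingHom.id_apply]

/-- The shuffle product of `T(V)`; see `one_shuffle`, `shuffle_one` and `ι_mul_shuffle_ι_mul`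
for the usual recursion. -/
def shuffle : TensorAlgebra K V →ₗ[K] TensorAlgebra K V →ₗ[K] TensorAlgebra K V :=
  LinearMap.applyₗ LinearMap.id ∘ₗ
    (TensorAlgebra.lift K (shuffleStep (K := K) (V := V))).toLinearMap

/-- Left multiplication by the letter `x` on pairs `(w, w • ·)`:
`(w, β) ↦ (xw, w' ↦ x β(w') + f(x)(w ⧢ w'))`. -/
def bulletStep (f : V →ₗ[K] V) : V →ₗ[K] Module.End K
    (TensorAlgebra K V × (TensorAlgebra K V →ₗ[K] TensorAlgebra K V)) where
  toFun x :=
    { toFun := fun p =>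
        (TensorAlgebra.ι K x * p.1,
          LinearMap.mulLeft K (TensorAlgebra.ι K x) ∘ₗ p.2 +
            LinearMap.mulLeft K (TensorAlgebra.ι K (f x)) ∘ₗ shuffle p.1)
      map_add' := fun p q => by
        refine Prod.ext ?_ (LinearMap.ext fun w => ?_)
        · simp [mul_add]
        · simp [mul_add]
          abel
      map_smul' := fun c p => by
        refine Prod.ext ?_ (LinearMap.ext fun w => ?_) <;> simp }
  map_add' x y := by
    refine LinearMap.ext fun p => Prod.ext ?_ (LinearMap.ext fun w => ?_)
    · simp [add_mul]
    · simp [add_mul]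
      abel
  map_smul' c x := by
    refine LinearMap.ext fun p => Prod.ext ?_ (LinearMap.ext fun w => ?_) <;> simp

/-- The pre-Lie product `•` of `T(V, f)`; see `one_bullet` and `ι_mul_bullet` for the recursion
`∅ • w' = 0`, `xw • w' = x(w • w') + f(x)(w ⧢ w')`. -/
def bullet (f : V →ₗ[K] V) :
    TensorAlgebra K V →ₗ[K] TensorAlgebra K V →ₗ[K] TensorAlgebra K V :=
  LinearMap.snd K _ _ ∘ₗ LinearMap.applyₗ (1, 0) ∘ₗ
    (TensorAlgebra.lift K (bulletStep f)).toLinearMap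

/-! The recursions satisfied by these maps. -/

theorem left_induction {C : TensorAlgebra K V → Prop} (h1 : C 1)
    (hadd : ∀ a b, C a → C b → C (a + b)) (hsmul : ∀ (c : K) a, C a → C (c • a))
    (hmul : ∀ x a, C a → C (TensorAlgebra.ι K x * a)) (a : TensorAlgebra K V) : C a := by
  have key : ∀ a b : TensorAlgebra K V, C b → C (a * b) := by
    intro a
    induction a using TensorAlgebra.induction with
    | algebraMap r => intro b hb; rw [← Algebra.smul_def]; exact hsmul r b hb
    | ι x => intro b hb; exact hmul x b hb
    | mul a a' iha iha' => intro b hb; rw [mul_assoc]; exact iha _ (iha' _ hb)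
    | add a a' iha iha' => intro b hb; rw [add_mul]; exact hadd _ _ (iha _ hb) (iha' _ hb)
  simpa using key a 1 h1

@[simp]
theorem deconc_one : deconc (1 : TensorAlgebra K V) = 1 ⊗ₜ[K] 1 := by
  simp [deconc]

theorem deconc_ι_mul (y : V) (v : TensorAlgebra K V) :
    deconc (TensorAlgebra.ι K y * v) =
      1 ⊗ₜ[K] (TensorAlgebra.ι K y * v) + (TensorAlgebra.ι K y ⊗ₜ[K] 1) * deconc v := by
  have h : ∀ v : TensorAlgebra K V,
      (TensorAlgebra.lift K (deconcStep (K := K) (V := V)) v (1, 1 ⊗ₜ[K] 1)).1 = v := by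
    intro v
    induction v using left_induction with
    | h1 => simp
    | hadd a b ha hb => simp [ha, hb]
    | hsmul c a ha => simp [ha]
    | hmul x a ha =>
      rw [map_mul, TensorAlgebra.lift_ι_apply, Module.End.mul_apply]
      exact congrArg (TensorAlgebra.ι K x * ·) ha
  change (TensorAlgebra.lift K deconcStep (TensorAlgebra.ι K y * v) (1, 1 ⊗ₜ[K] 1)).2 = _
  rw [map_mul, TensorAlgebra.lift_ι_apply, Module.End.mul_apply]
  change 1 ⊗ₜ[K] (TensorAlgebra.ι K y * _) + _ = _
  rw [h v]
  rfl

@[simp]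
theorem one_shuffle (b : TensorAlgebra K V) : shuffle 1 b = b := by
  simp [shuffle]

theorem ι_mul_shuffle (x : V) (u b : TensorAlgebra K V) :
    shuffle (TensorAlgebra.ι K x * u) b =
      LinearMap.mul' K (TensorAlgebra K V)
        (LinearMap.lTensor _ (LinearMap.mulLeft K (TensorAlgebra.ι K x) ∘ₗ shuffle u)
          (deconc b)) := by
  simp [shuffle, shuffleStep]

@[simp]
theorem shuffle_one (a : TensorAlgebra K V) : shuffle a 1 = a := by
  induction a using left_induction with
  | h1 => simp
  | hadd a b ha hb => simp [ha, hb]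
  | hsmul c a ha => simp [ha]
  | hmul x a ha => simp [ι_mul_shuffle, ha]

theorem ι_mul_shuffle_ι_mul (x y : V) (u v : TensorAlgebra K V) :
    shuffle (TensorAlgebra.ι K x * u) (TensorAlgebra.ι K y * v) =
      TensorAlgebra.ι K x * shuffle u (TensorAlgebra.ι K y * v) +
        TensorAlgebra.ι K y * shuffle (TensorAlgebra.ι K x * u) v := by
  rw [ι_mul_shuffle, ι_mul_shuffle, deconc_ι_mul]
  simp only [map_add, LinearMap.lTensor_tmul, LinearMap.mul'_apply, LinearMap.comp_apply,
    LinearMap.mulLeft_apply, one_mul]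
  congr 1
  induction deconc v using TensorProduct.induction_on with
  | zero => simp
  | tmul p q => simp [mul_assoc]
  | add p q hp hq => simp [mul_add, hp, hq]

@[simp]
theorem one_bullet (f : V →ₗ[K] V) (b : TensorAlgebra K V) : bullet f 1 b = 0 := by
  simp [bullet]

theorem ι_mul_bullet (f : V →ₗ[K] V) (x : V) (w w' : TensorAlgebra K V) :
    bullet f (TensorAlgebra.ι K x * w) w' =
      TensorAlgebra.ι K x * bullet f w w' + TensorAlgebra.ι K (f x) * shuffle w w' := by
  have h : ∀ v : TensorAlgebra K V,
      (TensorAlgebra.lift K (bulletStep f) v (1, 0)).1 = v := by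
    intro v
    induction v using left_induction with
    | h1 => simp
    | hadd a b ha hb => simp [ha, hb]
    | hsmul c a ha => simp [ha]
    | hmul x a ha =>
      rw [map_mul, TensorAlgebra.lift_ι_apply, Module.End.mul_apply]
      exact congrArg (TensorAlgebra.ι K x * ·) ha
  change (TensorAlgebra.lift K (bulletStep f) (TensorAlgebra.ι K x * w) (1, 0)).2 w' = _
  rw [map_mul, TensorAlgebra.lift_ι_apply, Module.End.mul_apply]
  change _ + TensorAlgebra.ι K (f x) * shuffle _ w' = _
  rw [h w]
  rfl

end Products

section Generation

variable {K : Type*} [Field K] {V : Type*} [AddCommGroup V] [Module K V]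

/-- The pre-Lie subalgebra of `T(V, f)` generated by `S`: the smallest linear subspace
containing `S` and stable under `•`. -/
def preLieAdjoin (f : V →ₗ[K] V) (S : Set (TensorAlgebra K V)) :
    Submodule K (TensorAlgebra K V) :=
  sInf {A | S ⊆ A ∧ ∀ a ∈ A, ∀ b ∈ A, bullet f a b ∈ A}

/-- The Com-Pre-Lie subalgebra of `T(V, f)` generated by `S`: the smallest linear subspace
containing `S` and stable under `⧢` and `•`. It is not required to contain `∅`. -/
def comPreLieAdjoin (f : V →ₗ[K] V) (S : Set (TensorAlgebra K V)) :
    Submodule K (TensorAlgebra K V) :=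
  sInf {A | S ⊆ A ∧ (∀ a ∈ A, ∀ b ∈ A, shuffle a b ∈ A) ∧ ∀ a ∈ A, ∀ b ∈ A, bullet f a b ∈ A}

/-- `T(W)`, seen inside `T(V)`. -/
def tensorSubspace (W : Submodule K V) : Submodule K (TensorAlgebra K V) :=
  LinearMap.range
    (TensorAlgebra.lift K (TensorAlgebra.ι K ∘ₗ W.subtype)).toLinearMap

/-- The element `x_{d₁}…x_{dₙ}` of `T(V)` given by a word `d₁…dₙ` and a family `x` of vectors. -/
def word {D : Type*} (x : D → V) (l : List D) : TensorAlgebra K V :=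
  (l.map fun d => TensorAlgebra.ι K (x d)).prod

/-- The set of all words in the letters `x d`. -/
def words (K : Type*) [Field K] {V : Type*} [AddCommGroup V] [Module K V] {D : Type*}
    (x : D → V) : Set (TensorAlgebra K V) :=
  Set.range (word x)

/-- A Lyndon word: a nonempty word that is lexicographically strictly smaller than each of its
proper nonempty suffixes. -/
def IsLyndon {D : Type*} [LinearOrder D] (l : List D) : Prop :=
  l ≠ [] ∧ ∀ u v : List D, u ≠ [] → v ≠ [] → l = u ++ v → l < v

/-- The empty word together with the Lyndon words in the letters `x d`. -/
def emptyAndLyndonWords (K : Type*) [Field K] {V : Type*} [AddCommGroup V] [Module K V]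
    {D : Type*} [LinearOrder D] (x : D → V) : Set (TensorAlgebra K V) :=
  insert 1 (word x '' {l | IsLyndon l})

end Generation

section Biletters

/-- `V_D`, the vector space with basis the biletters `(k, d)`, `k ∈ ℕ`, `d ∈ D`. -/
abbrev BiSpace (K : Type*) [Field K] (D : Type*) : Type _ := (ℕ × D) →₀ K

/-- `f_D`, the endomorphism of `V_D` sending `(k, d)` to `(k + 1, d)`. -/
def biShift (K : Type*) [Field K] (D : Type*) : BiSpace K D →ₗ[K] BiSpace K D :=
  Finsupp.lmapDomain K K fun p => (p.1 + 1, p.2)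

/-- The biletter `(0, d)`. -/
def biletterZero (K : Type*) [Field K] {D : Type*} (d : D) : BiSpace K D :=
  Finsupp.single (0, d) 1

end Biletters

end ComPreLie

end


/-!
Generation by words: the biletters `f^k (x d)` span `V`, so it suffices to reach the words in them.
A word with no positive exponent is a given generator. For a word `u (k + 1, d) l` where all the
exponents in `u` are `0`, expand `u (k, d) • l`, a product of two words of smaller total exponent:
besides `u (k + 1, d) l` it contains only words of the same total exponent whose first positive
exponent occurs earlier.

Words from Lyndon words: the largest shuffle of a nonincreasing sequence of Lyndon words is their
concatenation, occurring with a positive coefficient. As every word is uniquely such a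
concatenation, in characteristic zero the shuffle products of multisets of Lyndon words are
triangular with respect to the words. Hence they span all words (Radford's theorem), and they are
linearly independent when the letters are a basis.

Minimality: if the letters `x d` are linearly independent modulo the range of `f`, some `φ` kills
this range and maps them to a basis. The induced map `T(φ)` is compatible with `⧢` and kills every
product `•`. So it maps a subspace generated by some of the words to the span of their images, and
one generated by some of the Lyndon words and `∅` to the shuffle subspace generated by their
images, which is spanned by products of multisets of Lyndon words. In both cases linear independence
excludes the missing generator.
-/
noncomputable section

namespace ComPreLie

open TensorAlgebra (ι)

/-! ### Shuffles of words -/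

section LexOrder

variable {D : Type*} [LinearOrder D] {u v : List D}

-- The `≤` of Mathlib's order on lists is not the instance of core's lemmas, hence the restatements.
theorem nil_le (u : List D) : [] ≤ u :=
  not_lt.1 (List.nil_le u)

theorem cons_le_cons_iff {x y : D} : x :: u ≤ y :: v ↔ x < y ∨ x = y ∧ u ≤ v := by
  rw [← not_lt, List.cons_lt_cons_iff, ← not_lt (a := v)]
  grind

theorem le_append_right (u v : List D) : u ≤ u ++ v :=
  not_lt.1 List.le_append_left

theorem append_lt_of_lt_of_not_isPrefix (h : u < v) (hp : ¬ u <+: v) (t : List D) :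
    u ++ t < v := by
  induction u generalizing v with
  | nil => exact absurd v.nil_prefix hp
  | cons x u ih =>
    cases v with
    | nil => exact absurd h (List.not_lt_nil _)
    | cons y v =>
      refine List.cons_lt_cons_iff.2 ((List.cons_lt_cons_iff.1 h).imp_right ?_)
      rintro ⟨rfl, huv⟩
      exact ⟨rfl, ih huv fun hp' => hp (by simpa using hp')⟩

end LexOrder

section Shuffles

variable {D : Type*}

/-- The shuffles of two words, listed with multiplicity, so that the shuffle product of two words
of `T(V)` is the sum of this list. -/
def shuffles : List D → List D → List (List D)
  | [], v => [v]
  | x :: u, [] => [x :: u]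
  | x :: u, y :: v =>
    (shuffles u (y :: v)).map (x :: ·) ++ (shuffles (x :: u) v).map (y :: ·)
termination_by u v => u.length + v.length

@[simp]
theorem shuffles_nil_left (v : List D) : shuffles [] v = [v] := by
  rw [shuffles]

@[simp]
theorem shuffles_nil_right (u : List D) : shuffles u [] = [u] := by
  cases u <;> rw [shuffles]

theorem shuffles_cons_cons (x y : D) (u v : List D) :
    shuffles (x :: u) (y :: v) =
      (shuffles u (y :: v)).map (x :: ·) ++ (shuffles (x :: u) v).map (y :: ·) := by
  rw [shuffles]

theorem mem_shuffles_cons_cons {x y : D} {u v w : List D} :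
    w ∈ shuffles (x :: u) (y :: v) ↔
      (∃ w' ∈ shuffles u (y :: v), x :: w' = w) ∨ ∃ w' ∈ shuffles (x :: u) v, y :: w' = w := by
  simp only [shuffles_cons_cons, List.mem_append, List.mem_map]

theorem append_mem_shuffles (u v : List D) : u ++ v ∈ shuffles u v := by
  induction u with
  | nil => simp
  | cons x u ih =>
    cases v with
    | nil => simp
    | cons y v => exact mem_shuffles_cons_cons.2 (Or.inl ⟨_, ih, rfl⟩)

theorem perm_of_mem_shuffles {u v w : List D} (hw : w ∈ shuffles u v) : w.Perm (u ++ v) := by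
  induction u, v using shuffles.induct generalizing w with
  | case1 v => simp_all
  | case2 x u => simp_all
  | case3 x u y v ihu ihv =>
    rcases mem_shuffles_cons_cons.1 hw with ⟨w', hw', rfl⟩ | ⟨w', hw', rfl⟩
    · exact (ihu hw').cons x
    · exact ((ihv hw').cons y).trans List.perm_middle.symm

/-- The shuffles of a sequence of words, listed with multiplicity. -/
def shuffleAll : List (List D) → List (List D)
  | [] => [[]]
  | l :: m => (shuffleAll m).flatMap (shuffles l)

theorem flatten_mem_shuffleAll (m : List (List D)) : m.flatten ∈ shuffleAll m := by
  induction m with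
  | nil => simp [shuffleAll]
  | cons l m ih => exact List.mem_flatMap.2 ⟨_, ih, append_mem_shuffles l _⟩

theorem perm_of_mem_shuffleAll {m : List (List D)} {w : List D} (hw : w ∈ shuffleAll m) :
    w.Perm m.flatten := by
  induction m generalizing w with
  | nil => simp_all [shuffleAll]
  | cons l m ih =>
    obtain ⟨v, hv, hw⟩ := List.mem_flatMap.1 hw
    exact (perm_of_mem_shuffles hw).trans ((ih hv).append_left l)

/-- `IsShuffle w M` says that `w` is a shuffle of the words of the multiset `M`: reading `w` from
left to right, one empties the words of `M` by removing at each step the first letter of one of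
them. In contrast with `shuffleAll`, no order on the words of `M` is involved. -/
def IsShuffle : List D → Multiset (List D) → Prop
  | [], M => ∀ u ∈ M, u = []
  | c :: w, M => ∃ u N, M = (c :: u) ::ₘ N ∧ IsShuffle w (u ::ₘ N)

namespace IsShuffle

variable {u v w : List D} {M : Multiset (List D)}

theorem cons_cons (c : D) (h : IsShuffle w (u ::ₘ M)) :
    IsShuffle (c :: w) ((c :: u) ::ₘ M) :=
  ⟨u, M, rfl, h⟩

theorem nil_cons_iff : IsShuffle w ([] ::ₘ M) ↔ IsShuffle w M := by
  induction w generalizing M with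
  | nil => simp [IsShuffle]
  | cons c w ih =>
    constructor
    · rintro ⟨u, N, hM, h⟩
      obtain ⟨N, rfl, rfl⟩ : ∃ N', M = (c :: u) ::ₘ N' ∧ N = [] ::ₘ N' := by
        simpa [Multiset.cons_eq_cons] using hM
      exact .cons_cons c (ih.1 (Multiset.cons_swap [] u N ▸ h))
    · rintro ⟨u, N, rfl, h⟩
      rw [Multiset.cons_swap]
      exact .cons_cons c (Multiset.cons_swap [] u N ▸ ih.2 h)

theorem append (u : List D) (h : IsShuffle v M) : IsShuffle (u ++ v) (u ::ₘ M) := by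
  induction u with
  | nil => exact nil_cons_iff.2 h
  | cons c u ih => exact ih.cons_cons c

theorem exists_word (M : Multiset (List D)) : ∃ w, IsShuffle w M := by
  induction M using Multiset.induction_on with
  | empty => exact ⟨[], by simp [IsShuffle]⟩
  | cons u M ih => exact ih.imp' (u ++ ·) fun _ h => h.append u

theorem of_mem_shuffles (hv : IsShuffle v M) (hw : w ∈ shuffles u v) :
    IsShuffle w (u ::ₘ M) := by
  induction u, v using shuffles.induct generalizing w M with
  | case1 v =>
    obtain rfl : w = v := by simpa using hw
    exact nil_cons_iff.2 hv
  | case2 x u =>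
    obtain rfl : w = x :: u := by simpa using hw
    simpa using hv.append (x :: u)
  | case3 x u y v ihu ihv =>
    rcases mem_shuffles_cons_cons.1 hw with ⟨w', hw', rfl⟩ | ⟨w', hw', rfl⟩
    · exact (ihu hv hw').cons_cons x
    · obtain ⟨z, N, rfl, hz⟩ := hv
      rw [Multiset.cons_swap]
      exact .cons_cons y (Multiset.cons_swap _ z N ▸ ihv hz hw')

theorem of_mem_shuffleAll {m : List (List D)} (hw : w ∈ shuffleAll m) :
    IsShuffle w (m : Multiset (List D)) := by
  induction m generalizing w with
  | nil => simp_all [shuffleAll, IsShuffle]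
  | cons l m ih =>
    obtain ⟨v, hv, hw⟩ := List.mem_flatMap.1 hw
    exact (ih hv).of_mem_shuffles hw

theorem cons_cons_iff {c : D} :
    IsShuffle (c :: w) (v ::ₘ M) ↔
      (∃ v', v = c :: v' ∧ IsShuffle w (v' ::ₘ M)) ∨
        ∃ u N, M = (c :: u) ::ₘ N ∧ IsShuffle w (u ::ₘ v ::ₘ N) := by
  constructor
  · rintro ⟨u, N, h, hw⟩
    rcases Multiset.cons_eq_cons.1 h with ⟨rfl, rfl⟩ | ⟨-, N, rfl, rfl⟩
    · exact Or.inl ⟨u, rfl, hw⟩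
    · exact Or.inr ⟨u, N, rfl, hw⟩
  · rintro (⟨v', rfl, hw⟩ | ⟨u, N, rfl, hw⟩)
    · exact hw.cons_cons c
    · exact Multiset.cons_swap v _ N ▸ hw.cons_cons c

theorem eq_of_singleton (h : IsShuffle w {u}) : w = u := by
  induction w generalizing u with
  | nil => simpa [IsShuffle, eq_comm] using h
  | cons c w ih =>
    rcases cons_cons_iff.1 h with ⟨v, rfl, hw⟩ | ⟨v, N, hN, -⟩
    · rw [ih hw]
    · exact absurd hN.symm (Multiset.cons_ne_zero)

/-- Exchange argument: of two words, it pays to start with the larger one. With `p` a single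
letter, it bounds a shuffle of `p a` and `p v` starting with the first letter of `p v`. -/
theorem exists_le_of_le [LinearOrder D] {a p : List D} (h : v ≤ a)
    (hw : IsShuffle w ((p ++ a) ::ₘ v ::ₘ M)) :
    ∃ w', w ≤ w' ∧ IsShuffle w' (a ::ₘ (p ++ v) ::ₘ M) := by
  induction w generalizing a v p M with
  | nil => exact (exists_word _).imp fun w' hw' => ⟨nil_le w', hw'⟩
  | cons c w ih =>
    rcases p with _ | ⟨d, p⟩
    · exact ⟨c :: w, le_rfl, hw⟩
    have cons_le {v' a' p' : List D} {N : Multiset (List D)} (h' : v' ≤ a')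
        (hw' : IsShuffle w ((p' ++ a') ::ₘ v' ::ₘ N)) :
        ∃ w', c :: w ≤ c :: w' ∧ IsShuffle w' (a' ::ₘ (p' ++ v') ::ₘ N) :=
      (ih h' hw').imp fun w' hw' => ⟨cons_le_cons_iff.2 (Or.inr ⟨rfl, hw'.1⟩), hw'.2⟩
    rcases cons_cons_iff.1 hw with ⟨l, hl, hw⟩ | ⟨u, N, hN, hw⟩
    · obtain ⟨rfl, rfl⟩ : d = c ∧ p ++ a = l := by simpa using hl
      obtain ⟨w', hle, hw'⟩ := cons_le h hw
      rw [Multiset.cons_swap] at hw' ⊢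
      exact ⟨d :: w', hle, hw'.cons_cons d⟩
    rcases Multiset.cons_eq_cons.1 hN with ⟨rfl, rfl⟩ | ⟨-, N, rfl, rfl⟩
    · obtain ⟨e, a, rfl⟩ : ∃ e a', a = e :: a' := List.exists_cons_of_ne_nil <| by
        rintro rfl
        exact h.not_gt (List.nil_lt_cons c u)
      rcases cons_le_cons_iff.1 h with hlt | ⟨rfl, hle⟩
      · obtain ⟨w', hw'⟩ := exists_word (a ::ₘ (d :: p ++ c :: u) ::ₘ M)
        exact ⟨e :: w', cons_le_cons_iff.2 (Or.inl hlt), hw'.cons_cons e⟩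
      · rw [Multiset.cons_swap, List.append_cons] at hw
        obtain ⟨w', hle, hw'⟩ := cons_le hle hw
        rw [← List.append_cons] at hw'
        exact ⟨c :: w', hle, hw'.cons_cons c⟩
    · have rotate (x y z : List D) : x ::ₘ y ::ₘ z ::ₘ N = y ::ₘ z ::ₘ x ::ₘ N := by
        rw [Multiset.cons_swap x, Multiset.cons_swap x]
      rw [rotate] at hw
      obtain ⟨w', hle, hw'⟩ := cons_le h hw
      rw [← rotate] at hw' ⊢
      exact ⟨c :: w', hle, hw'.cons_cons c⟩

end IsShuffle

end Shuffles

/-! ### Lyndon words -/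

section Lyndon

variable {D : Type*} [LinearOrder D]

theorem IsLyndon.le_of_isSuffix {l s : List D} (hl : IsLyndon l) (hs : s ≠ []) (h : s <:+ l) :
    l ≤ s := by
  obtain ⟨p, rfl⟩ := h
  rcases eq_or_ne p [] with rfl | hp
  · rfl
  · exact (hl.2 p s hp hs rfl).le

theorem IsLyndon.append_lt {a s : List D} (hs : IsLyndon s) (ha : a ≠ []) (h : a < s) :
    a ++ s < s := by
  by_cases hp : a <+: s
  · obtain ⟨t, rfl⟩ := hp
    have ht : t ≠ [] := by
      rintro rfl
      simp at h
    exact List.append_left_lt (hs.2 a t ha ht rfl)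
  · exact append_lt_of_lt_of_not_isPrefix h hp s

/-- A nonincreasing sequence of Lyndon words. -/
def IsLyndonSeq (m : List (List D)) : Prop :=
  (∀ a ∈ m, IsLyndon a) ∧ m.Pairwise (· ≥ ·)

theorem isLyndonSeq_nil : IsLyndonSeq ([] : List (List D)) :=
  ⟨by simp, .nil⟩

theorem isLyndonSeq_cons {a : List D} {m : List (List D)} :
    IsLyndonSeq (a :: m) ↔ IsLyndon a ∧ (∀ b ∈ m, b ≤ a) ∧ IsLyndonSeq m := by
  simp only [IsLyndonSeq, List.forall_mem_cons, List.pairwise_cons, ge_iff_le]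
  tauto

theorem isLyndonSeq_append_singleton {a : List D} {m : List (List D)} :
    IsLyndonSeq (m ++ [a]) ↔ IsLyndonSeq m ∧ IsLyndon a ∧ ∀ b ∈ m, a ≤ b := by
  simp only [IsLyndonSeq, List.pairwise_append, List.forall_mem_append, List.forall_mem_singleton,
    List.pairwise_singleton, ge_iff_le]
  tauto

/-- By induction on `w`: as long as `w` starts with a letter of `s`, there is nothing to do. If it
starts with a letter of some `a ∈ m`, then `a ≤ s`, and exchanging `a` and `s` yields a larger
shuffle. Once `s` is exhausted, the largest word of `m` plays its role. -/
theorem IsLyndonSeq.le_append_flatten_of_isShuffle {m : List (List D)} (hm : IsLyndonSeq m)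
    {s w : List D} (hs : ∀ t, t <:+ s → t ≠ [] → ∀ a ∈ m, a ≤ t)
    (hw : IsShuffle w (s ::ₘ (m : Multiset (List D)))) : w ≤ s ++ m.flatten := by
  induction m generalizing s w with
  | nil => simpa using hw.eq_of_singleton.le
  | cons a m ihm =>
    obtain ⟨ha, ham, hm'⟩ := isLyndonSeq_cons.1 hm
    induction s generalizing w with
    | nil =>
      rw [IsShuffle.nil_cons_iff] at hw
      exact ihm hm' (fun t hta ht b hb => (ham b hb).trans (ha.le_of_isSuffix ht hta)) hw
    | cons x s ihs =>
      replace ihs {w : List D} := @ihs w fun t ht => hs t (ht.trans (s.suffix_cons x))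
      rcases w with _ | ⟨c, w⟩
      · exact nil_le _
      rcases IsShuffle.cons_cons_iff.1 hw with ⟨s', hs', hw⟩ | ⟨u, N, hN, hw⟩
      · obtain ⟨rfl, rfl⟩ := List.cons_eq_cons.1 hs'
        exact cons_le_cons_iff.2 (Or.inr ⟨rfl, ihs hw⟩)
      · have hu : c :: u ∈ a :: m := by
          rw [← Multiset.mem_coe, hN]
          exact Multiset.mem_cons_self _ _
        rcases cons_le_cons_iff.1 (hs _ List.suffix_rfl (by simp) _ hu) with hlt | ⟨rfl, hle⟩
        · exact cons_le_cons_iff.2 (Or.inl hlt)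
        · rw [Multiset.cons_swap] at hw
          obtain ⟨w', hww', hw'⟩ := IsShuffle.exists_le_of_le (p := [c]) hle hw
          rw [List.singleton_append, ← hN] at hw'
          exact cons_le_cons_iff.2 (Or.inr ⟨rfl, hww'.trans (ihs hw')⟩)

theorem IsLyndonSeq.le_flatten_of_isShuffle {m : List (List D)} (hm : IsLyndonSeq m) {w : List D}
    (hw : IsShuffle w (m : Multiset (List D))) : w ≤ m.flatten :=
  hm.le_append_flatten_of_isShuffle (s := []) (by simp) (IsShuffle.nil_cons_iff.2 hw)

theorem IsLyndonSeq.last_le_of_isSuffix {m : List (List D)} {a s : List D}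
    (hm : IsLyndonSeq (m ++ [a])) (hs : s ≠ []) (h : s <:+ (m ++ [a]).flatten) : a ≤ s := by
  induction m with
  | nil => exact (hm.1 a (by simp)).le_of_isSuffix hs (by simpa using h)
  | cons b m ih =>
    obtain ⟨hb, hmb, hm'⟩ := isLyndonSeq_cons.1 hm
    rw [List.cons_append, List.flatten_cons] at h
    obtain ⟨p, hp⟩ := h
    rcases List.append_eq_append_iff.1 hp with ⟨t, rfl, rfl⟩ | ⟨t, -, ht⟩
    · rcases eq_or_ne t [] with rfl | ht
      · exact ih hm' List.suffix_rfl
      · calc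
          a ≤ p ++ t := hmb a (by simp)
          _ ≤ t := hb.le_of_isSuffix ht (List.suffix_append p t)
          _ ≤ t ++ (m ++ [a]).flatten := le_append_right t _
    · exact ih hm' ⟨t, ht.symm⟩

theorem IsLyndonSeq.eq_of_flatten_eq {m m' : List (List D)} (hm : IsLyndonSeq m)
    (hm' : IsLyndonSeq m') (h : m.flatten = m'.flatten) : m = m' := by
  induction m using List.reverseRecOn generalizing m' with
  | nil =>
    refine (List.eq_nil_iff_forall_not_mem.2 fun a ha => (hm'.1 a ha).1 ?_).symm
    exact List.flatten_eq_nil_iff.1 h.symm a ha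
  | append_singleton m a ih =>
    rcases m'.eq_nil_or_concat' with rfl | ⟨m', b, rfl⟩
    · exact absurd (List.flatten_eq_nil_iff.1 h a (by simp)) (hm.1 a (by simp)).1
    · have hab : a ≤ b := hm.last_le_of_isSuffix (hm'.1 b (by simp)).1 (by simp [h])
      have hba : b ≤ a := hm'.last_le_of_isSuffix (hm.1 a (by simp)).1 (by simp [← h])
      obtain rfl := le_antisymm hab hba
      rw [ih (isLyndonSeq_append_singleton.1 hm).1 (isLyndonSeq_append_singleton.1 hm').1
        (by simpa using h)]

theorem exists_isSuffix_forall_le {w : List D} (hw : w ≠ []) :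
    ∃ s, s <:+ w ∧ s ≠ [] ∧ ∀ t, t <:+ w → t ≠ [] → s ≤ t := by
  obtain ⟨s, hs, hmin⟩ := (w.tails.toFinset.filter (· ≠ [])).exists_min_image id ⟨w, by simp [hw]⟩
  simp only [Finset.mem_filter, List.mem_toFinset, List.mem_tails, id] at hs hmin
  exact ⟨s, hs.1, hs.2, fun t ht ht0 => hmin t ⟨ht, ht0⟩⟩

theorem isLyndon_of_forall_isSuffix_le {s : List D} (hs : s ≠ [])
    (h : ∀ t, t <:+ s → t ≠ [] → s ≤ t) : IsLyndon s := by
  refine ⟨hs, ?_⟩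
  rintro u v hu hv rfl
  exact (h v (List.suffix_append u v) hv).lt_of_ne (by simpa using hu)

/-- The Chen–Fox–Lyndon factorization: its last factor is the smallest nonempty suffix of `w`. -/
theorem exists_isLyndonSeq_flatten_eq (w : List D) : ∃ m, IsLyndonSeq m ∧ m.flatten = w := by
  induction hn : w.length using Nat.strong_induction_on generalizing w with
  | _ n ih =>
    rcases eq_or_ne w [] with rfl | hw
    · exact ⟨[], isLyndonSeq_nil, rfl⟩
    obtain ⟨s, ⟨p, rfl⟩, hs, hmin⟩ := exists_isSuffix_forall_le hw
    have hsL : IsLyndon s :=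
      isLyndon_of_forall_isSuffix_le hs fun t ht => hmin t (ht.trans (List.suffix_append p s))
    have hlt : p.length < n := by simpa [← hn] using List.length_pos_iff.2 hs
    obtain ⟨m, hm, rfl⟩ := ih p.length hlt p rfl
    refine ⟨m ++ [s], isLyndonSeq_append_singleton.2 ⟨hm, hsL, ?_⟩, by simp⟩
    rcases m.eq_nil_or_concat' with rfl | ⟨m, a, rfl⟩
    · simp
    · obtain ⟨-, ha, hma⟩ := isLyndonSeq_append_singleton.1 hm
      have hsa : s ≤ a := by
        by_contra! has
        exact (hsL.append_lt ha.1 has).not_ge (hmin _ ⟨m.flatten, by simp⟩ (by simp [hs]))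
      simpa [hsa, or_imp, forall_and] using fun b hb => hsa.trans (hma b hb)

end Lyndon

/-! ### The shuffle algebra -/

section ShuffleAlgebra

variable {K : Type*} [Field K] {V : Type*} [AddCommGroup V] [Module K V]

theorem shuffle_comm (a b : TensorAlgebra K V) : shuffle a b = shuffle b a := by
  induction a using left_induction generalizing b with
  | h1 => simp
  | hadd a a' ha ha' => simp [ha, ha']
  | hsmul c a ha => simp [ha]
  | hmul x a ha =>
    induction b using left_induction with
    | h1 => simp
    | hadd b b' hb hb' => simp [hb, hb']
    | hsmul c b hb => simp [hb]
    | hmul y b hb => rw [ι_mul_shuffle_ι_mul, ι_mul_shuffle_ι_mul, hb, ha, add_comm]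

theorem shuffle_shuffle_ι_mul (x y z : V) (a b c : TensorAlgebra K V) :
    shuffle (shuffle (ι K x * a) (ι K y * b)) (ι K z * c) =
      ι K x * shuffle (shuffle a (ι K y * b)) (ι K z * c) +
        ι K y * shuffle (shuffle (ι K x * a) b) (ι K z * c) +
          ι K z * shuffle (shuffle (ι K x * a) (ι K y * b)) c := by
  simp only [ι_mul_shuffle_ι_mul x y, map_add, LinearMap.add_apply, ι_mul_shuffle_ι_mul _ z,
    mul_add]
  abel

theorem shuffle_assoc (a b c : TensorAlgebra K V) :
    shuffle (shuffle a b) c = shuffle a (shuffle b c) := by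
  induction a using left_induction generalizing b c with
  | h1 => simp
  | hadd a a' ha ha' => simp [ha, ha']
  | hsmul r a ha => simp [ha]
  | hmul x a ha =>
    induction b using left_induction generalizing c with
    | h1 => simp
    | hadd b b' hb hb' => simp [hb, hb']
    | hsmul r b hb => simp [hb]
    | hmul y b hb =>
      induction c using left_induction with
      | h1 => simp
      | hadd c c' hc hc' => simp [hc, hc']
      | hsmul r c hc => simp [hc]
      | hmul z c hc =>
        have comm_left (p : TensorAlgebra K V) := shuffle_comm (ι K x * a) p
        rw [shuffle_shuffle_ι_mul, ha, hb, hc, shuffle_comm a, comm_left (shuffle b _),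
          comm_left (shuffle _ c), comm_left (shuffle _ (ι K z * c)), shuffle_shuffle_ι_mul]
        abel

theorem shuffle_left_comm (a b c : TensorAlgebra K V) :
    shuffle a (shuffle b c) = shuffle b (shuffle a c) := by
  rw [← shuffle_assoc, shuffle_comm a, shuffle_assoc]

section Map

variable {V' : Type*} [AddCommGroup V'] [Module K V'] (φ : V →ₗ[K] V')

/-- The algebra morphism `T(V) → T(V')` induced by a linear map. -/
def tensorMap : TensorAlgebra K V →ₐ[K] TensorAlgebra K V' :=
  TensorAlgebra.lift K (ι K ∘ₗ φ)

@[simp]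
theorem tensorMap_ι (x : V) : tensorMap φ (ι K x) = ι K (φ x) := by
  simp [tensorMap]

theorem tensorMap_shuffle (a b : TensorAlgebra K V) :
    tensorMap φ (shuffle a b) = shuffle (tensorMap φ a) (tensorMap φ b) := by
  induction a using left_induction generalizing b with
  | h1 => simp
  | hadd a a' ha ha' => simp [ha, ha']
  | hsmul c a ha => simp [ha]
  | hmul x a ha =>
    induction b using left_induction with
    | h1 => simp
    | hadd b b' hb hb' => simp [hb, hb']
    | hsmul c b hb => simp [hb]
    | hmul y b hb => simp [ι_mul_shuffle_ι_mul, ha, hb] at hb ⊢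

theorem tensorMap_bullet_eq_zero {φ : V →ₗ[K] V'} {f : V →ₗ[K] V} (hφ : φ ∘ₗ f = 0)
    (a b : TensorAlgebra K V) : tensorMap φ (bullet f a b) = 0 := by
  induction a using left_induction with
  | h1 => simp
  | hadd a a' ha ha' => simp [ha, ha']
  | hsmul c a ha => simp [ha]
  | hmul x a ha =>
    have hx : φ (f x) = 0 := LinearMap.congr_fun hφ x
    simp [ι_mul_bullet, ha, hx]

end Map

section Word

variable {D : Type*} (x : D → V)

@[simp]
theorem word_nil : word (K := K) x [] = 1 := by
  simp [word]

@[simp]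
theorem word_cons (d : D) (l : List D) : word (K := K) x (d :: l) = ι K (x d) * word x l := by
  simp [word]

@[simp]
theorem word_append (l l' : List D) : word (K := K) x (l ++ l') = word x l * word x l' := by
  simp [word]

theorem tensorMap_word {V' : Type*} [AddCommGroup V'] [Module K V'] (φ : V →ₗ[K] V')
    (l : List D) : tensorMap φ (word x l) = word (φ ∘ x) l := by
  simp [word, map_list_prod, Function.comp_def]

theorem shuffle_word (u v : List D) :
    shuffle (word (K := K) x u) (word x v) = ((shuffles u v).map (word x)).sum := by
  induction u, v using shuffles.induct with
  | case1 v => simp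
  | case2 d u => simp
  | case3 d u e v ihu ihv =>
    rw [word_cons, word_cons, ι_mul_shuffle_ι_mul, ← word_cons, ← word_cons, ihu, ihv,
      shuffles_cons_cons]
    simp [← List.sum_map_mul_left, Function.comp_def]

instance leftCommutative_shuffle_word :
    LeftCommutative fun (l : List D) (a : TensorAlgebra K V) => shuffle (word x l) a :=
  ⟨fun _ _ => shuffle_left_comm _ _⟩

/-- The shuffle product of a multiset of words in the letters `x d`. -/
def shuffleProd (M : Multiset (List D)) : TensorAlgebra K V :=
  M.foldr (fun l a => shuffle (word x l) a) 1

@[simp]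
theorem shuffleProd_zero : shuffleProd (K := K) x 0 = 1 :=
  rfl

@[simp]
theorem shuffleProd_cons (l : List D) (M : Multiset (List D)) :
    shuffleProd (K := K) x (l ::ₘ M) = shuffle (word x l) (shuffleProd x M) :=
  Multiset.foldr_cons ..

@[simp]
theorem shuffleProd_singleton (l : List D) : shuffleProd (K := K) x {l} = word x l :=
  shuffle_one _

theorem shuffleProd_add (M N : Multiset (List D)) :
    shuffleProd (K := K) x (M + N) = shuffle (shuffleProd x M) (shuffleProd x N) := by
  induction M using Multiset.induction_on with
  | empty => simp
  | cons l M ih => simp [ih, shuffle_assoc]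

theorem shuffleProd_coe (m : List (List D)) :
    shuffleProd (K := K) x (m : Multiset (List D)) = ((shuffleAll m).map (word x)).sum := by
  induction m with
  | nil => simp [shuffleAll]
  | cons l m ih =>
    rw [← Multiset.cons_coe, shuffleProd_cons, ih, shuffleAll, map_list_sum]
    simp [List.flatMap_def, List.sum_flatten, shuffle_word, Function.comp_def]

theorem shuffleProd_mem {x : D → V} {A : Submodule K (TensorAlgebra K V)}
    (hone : 1 ∈ A) (hA : ∀ a ∈ A, ∀ b ∈ A, shuffle a b ∈ A) {M : Multiset (List D)}
    (hM : ∀ l ∈ M, word x l ∈ A) : shuffleProd x M ∈ A := by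
  induction M using Multiset.induction_on with
  | empty => exact hone
  | cons l M ih =>
    rw [Multiset.forall_mem_cons] at hM
    rw [shuffleProd_cons]
    exact hA _ hM.1 _ (ih hM.2)

theorem emptyAndLyndonWords_eq [LinearOrder D] :
    emptyAndLyndonWords K x =
      shuffleProd x '' {M | M.card ≤ 1 ∧ ∀ l ∈ M, IsLyndon l} := by
  have hset : {M : Multiset (List D) | M.card ≤ 1 ∧ ∀ l ∈ M, IsLyndon l} =
      insert 0 ((fun l => {l}) '' {l | IsLyndon l}) := by
    ext M
    rw [Set.mem_ofPred_eq, Nat.le_one_iff_eq_zero_or_eq_one, Multiset.card_eq_zero,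
      Multiset.card_eq_one]
    constructor
    · rintro ⟨rfl | ⟨l, rfl⟩, hM⟩
      · exact Or.inl rfl
      · exact Or.inr ⟨l, hM l (Multiset.mem_singleton_self l), rfl⟩
    · rintro (rfl | ⟨l, hl, rfl⟩)
      · simp
      · simpa using hl
  rw [hset, Set.image_insert_eq, Set.image_image]
  simp [emptyAndLyndonWords]

end Word

end ShuffleAlgebra

/-! ### Radford's theorem -/

section Radford

variable {K : Type*} [Field K] [CharZero K] {V : Type*} [AddCommGroup V] [Module K V]
  {D : Type*} [LinearOrder D]

/-- Radford's theorem. If `m` is the nonincreasing factorization of a word `u` into Lyndon words,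
then `u` is the largest term of the shuffle product of `m`, and its coefficient is positive. -/
theorem word_mem_of_emptyAndLyndonWords_subset {x : D → V} {A : Submodule K (TensorAlgebra K V)}
    (hS : emptyAndLyndonWords K x ⊆ A) (hA : ∀ a ∈ A, ∀ b ∈ A, shuffle a b ∈ A) (w : List D) :
    word x w ∈ A := by
  have hwf : {u : List D | u.Perm w}.WellFoundedOn (· < ·) :=
    (w.permutations.toFinset.finite_toSet.subset fun u hu => by simpa using hu).wellFoundedOn
  refine hwf.induction (P := (word x · ∈ A)) (List.Perm.refl w) fun u hu ih => ?_
  obtain ⟨m, hm, rfl⟩ := exists_isLyndonSeq_flatten_eq u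
  have hprod : shuffleProd x (m : Multiset (List D)) ∈ A :=
    shuffleProd_mem (hS (Or.inl rfl)) hA fun l hl => hS (Or.inr ⟨l, hm.1 l hl, rfl⟩)
  have hsmaller : ∀ v ∈ (shuffleAll m).toFinset.erase m.flatten, word x v ∈ A := by
    intro v hv
    obtain ⟨hne, hv⟩ := Finset.mem_erase.1 hv
    rw [List.mem_toFinset] at hv
    exact ih v ((perm_of_mem_shuffleAll hv).trans hu)
      ((hm.le_flatten_of_isShuffle (.of_mem_shuffleAll hv)).lt_of_ne hne)
  have hmem := flatten_mem_shuffleAll m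
  rw [shuffleProd_coe, Finset.sum_list_map_count,
    ← Finset.add_sum_erase _ _ (List.mem_toFinset.2 hmem),
    A.add_mem_iff_left (A.sum_mem fun v hv => A.nsmul_mem (hsmaller v hv) _),
    ← Nat.cast_smul_eq_nsmul K] at hprod
  exact (A.smul_mem_iff (Nat.cast_ne_zero.2 (by simpa [List.count_eq_zero] using hmem))).1 hprod

end Radford

theorem linearIndependent_of_triangular {R M I J : Type*} [Ring R] [NoZeroDivisors R]
    [AddCommGroup M] [Module R M] [LinearOrder I] {c : I → M →ₗ[R] R} {v : J → M} {lead : J → I}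
    (hlead : Function.Injective lead) (hdiag : ∀ j, c (lead j) (v j) ≠ 0)
    (htri : ∀ i j, c i (v j) ≠ 0 → i ≤ lead j) : LinearIndependent R v := by
  classical
  refine linearIndependent_iff'.2 fun s a hsum => ?_
  by_contra! h
  obtain ⟨j, hj, hmax⟩ := (s.filter (a · ≠ 0)).exists_max_image lead (by simpa [Finset.Nonempty])
  rw [Finset.mem_filter] at hj
  have hcoeff : ∑ k ∈ s, a k * c (lead j) (v k) = 0 := by
    simpa using congrArg (c (lead j)) hsum
  rw [Finset.sum_eq_single_of_mem j hj.1] at hcoeff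
  · exact mul_ne_zero hj.2 (hdiag j) hcoeff
  · intro k hk hkj
    by_contra! hne
    rw [mul_ne_zero_iff] at hne
    exact hkj (hlead ((hmax k (Finset.mem_filter.2 ⟨hk, hne.1⟩)).antisymm (htri _ _ hne.2)))

section WordBasis

variable {K : Type*} [Field K] {V : Type*} [AddCommGroup V] [Module K V] {D : Type*}

/-- The basis of `T(V)` consisting of the words in the elements of a basis of `V`. -/
def wordBasis (b : Module.Basis D K V) : Module.Basis (List D) K (TensorAlgebra K V) :=
  b.tensorAlgebra.reindex FreeMonoid.toList

theorem basisFreeMonoid_apply (u : FreeMonoid D) :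
    FreeAlgebra.basisFreeMonoid K D u = (u.toList.map (FreeAlgebra.ι K)).prod := by
  rw [FreeAlgebra.basisFreeMonoid, Module.Basis.map_apply, Finsupp.coe_basisSingleOne]
  change MonoidAlgebra.lift K (FreeAlgebra K D) (FreeMonoid D) (FreeMonoid.lift (FreeAlgebra.ι K))
    (MonoidAlgebra.single u 1) = _
  rw [MonoidAlgebra.lift_single, one_smul, FreeMonoid.lift_apply]

theorem wordBasis_apply (b : Module.Basis D K V) (u : List D) : wordBasis b u = word b u := by
  simp only [wordBasis, Module.Basis.reindex_apply, Module.Basis.tensorAlgebra,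
    Module.Basis.map_apply, basisFreeMonoid_apply]
  simp only [AlgEquiv.toLinearEquiv_apply, map_list_prod, List.map_map, word]
  congr 2
  ext d
  simp

theorem wordBasis_repr_sum_map_word [DecidableEq D] (b : Module.Basis D K V) (L : List (List D))
    (u : List D) : (wordBasis b).repr (L.map (word b)).sum u = (L.count u : K) := by
  induction L with
  | nil => simp
  | cons v L ih =>
    rw [List.map_cons, List.sum_cons, map_add, Finsupp.add_apply, ih, ← wordBasis_apply,
      Module.Basis.repr_self, List.count_cons, Finsupp.single_apply, add_comm]
    simp

theorem linearIndepOn_shuffleProd [CharZero K] [LinearOrder D] (b : Module.Basis D K V) :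
    LinearIndepOn K (shuffleProd (K := K) b) {M | ∀ l ∈ M, IsLyndon l} := by
  have hseq (M : {M : Multiset (List D) | ∀ l ∈ M, IsLyndon l}) :
      IsLyndonSeq (M.1.sort (· ≥ ·)) :=
    ⟨fun l hl => M.2 l ((Multiset.mem_sort _).1 hl), M.1.pairwise_sort _⟩
  have hcoord (u : List D) (M : Multiset (List D)) :
      (wordBasis b).coord u (shuffleProd b M) = ((shuffleAll (M.sort (· ≥ ·))).count u : K) := by
    rw [Module.Basis.coord_apply, ← wordBasis_repr_sum_map_word b, ← shuffleProd_coe,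
      Multiset.sort_eq]
  refine linearIndependent_of_triangular (c := (wordBasis b).coord)
    (lead := fun M => (M.1.sort (· ≥ ·)).flatten) ?_ ?_ ?_
  · intro M N h
    have hsort := (hseq M).eq_of_flatten_eq (hseq N) h
    exact Subtype.ext (by rw [← M.1.sort_eq (· ≥ ·), hsort, Multiset.sort_eq])
  · intro M
    rw [hcoord, Nat.cast_ne_zero]
    exact (List.count_pos_iff.2 (flatten_mem_shuffleAll _)).ne'
  · intro u M hu
    rw [hcoord, Nat.cast_ne_zero, ← Nat.pos_iff_ne_zero, List.count_pos_iff] at hu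
    exact (hseq M).le_flatten_of_isShuffle (.of_mem_shuffleAll hu)

end WordBasis

/-! ### Generation -/

section Generation

variable {K : Type*} [Field K] {V : Type*} [AddCommGroup V] [Module K V] {D : Type*}

theorem bullet_word_mul (f : V →ₗ[K] V) (x : D → V) (p : List D) (a b : TensorAlgebra K V) :
    bullet f (word x p * a) b =
      word x p * bullet f a b +
        ∑ i : Fin p.length, word x (p.take i) *
          (ι K (f (x p[i])) * shuffle (word x (p.drop (i + 1)) * a) b) := by
  induction p with
  | nil => simp
  | cons d p ih =>
    rw [word_cons, mul_assoc, ι_mul_bullet, ih, mul_add, add_assoc, mul_assoc]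
    congr 1
    refine (add_comm _ _).trans (.trans ?_ (Fin.sum_univ_succ _).symm)
    simp [Finset.mul_sum, mul_assoc]

theorem word_mul_shuffle_mem {x : D → V} {A : Submodule K (TensorAlgebra K V)} {p u v : List D}
    (h : ∀ w ∈ shuffles u v, word x (p ++ w) ∈ A) :
    word x p * shuffle (word x u) (word x v) ∈ A := by
  rw [shuffle_word, ← List.sum_map_mul_left]
  refine list_sum_mem fun a ha => ?_
  obtain ⟨w, hw, rfl⟩ := List.mem_map.1 ha
  simpa using h w hw

/-- The biletters `f^k (x d)` of `V`, which are those of the paper when `f` is `biShift K D` and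
`x` is `biletterZero K`. -/
def biletter (f : V →ₗ[K] V) (x : D → V) (p : ℕ × D) : V :=
  (f ^ p.1) (x p.2)

theorem biletter_succ (f : V →ₗ[K] V) (x : D → V) (k : ℕ) (d : D) :
    biletter f x (k + 1, d) = f (biletter f x (k, d)) := by
  simp [biletter, pow_succ']

theorem word_biletter_map_zero (f : V →ₗ[K] V) (x : D → V) (u : List D) :
    word (K := K) (biletter f x) (u.map (Prod.mk 0)) = word x u := by
  simp [word, biletter, Function.comp_def]

/-- The sum of the exponents of a word in the biletters: `⧢` preserves it and `•` increases it
by one. -/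
def weight (l : List (ℕ × D)) : ℕ :=
  (l.map Prod.fst).sum

@[simp]
theorem weight_nil : weight ([] : List (ℕ × D)) = 0 :=
  rfl

@[simp]
theorem weight_cons (p : ℕ × D) (l : List (ℕ × D)) : weight (p :: l) = p.1 + weight l := by
  simp [weight]

@[simp]
theorem weight_append (l l' : List (ℕ × D)) : weight (l ++ l') = weight l + weight l' := by
  simp [weight]

@[simp]
theorem weight_map_zero (u : List D) : weight (u.map (Prod.mk 0)) = 0 := by
  induction u <;> simp_all

theorem weight_of_mem_shuffles {u v w : List (ℕ × D)} (hw : w ∈ shuffles u v) :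
    weight w = weight u + weight v := by
  rw [← weight_append]
  exact ((perm_of_mem_shuffles hw).map Prod.fst).sum_eq

theorem eq_map_zero_or_exists_succ (l : List (ℕ × D)) :
    (∃ u : List D, l = u.map (Prod.mk 0)) ∨
      ∃ (u : List D) (k : ℕ) (d : D) (l' : List (ℕ × D)),
        l = u.map (Prod.mk 0) ++ (k + 1, d) :: l' := by
  induction l with
  | nil => exact Or.inl ⟨[], rfl⟩
  | cons a l ih =>
    obtain ⟨_ | k, e⟩ := a
    · rcases ih with ⟨u, rfl⟩ | ⟨u, k, d, l', rfl⟩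
      · exact Or.inl ⟨e :: u, rfl⟩
      · exact Or.inr ⟨e :: u, k, d, l', rfl⟩
    · exact Or.inr ⟨[], k, e, l, rfl⟩

variable {f : V →ₗ[K] V} {x : D → V} {A : Submodule K (TensorAlgebra K V)}

/-- The product `u (k, d) • l` is the sum of `u (k + 1, d) l` and of words of the same weight whose
first letter of positive exponent comes earlier. -/
theorem word_map_zero_append_mem (hA : ∀ a ∈ A, ∀ b ∈ A, bullet f a b ∈ A) (u : List D) (k : ℕ)
    (d : D) (l : List (ℕ × D))
    (hlt : ∀ l', weight l' < k + 1 + weight l → word (biletter f x) l' ∈ A) :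
    word (biletter f x) (u.map (Prod.mk 0) ++ (k + 1, d) :: l) ∈ A := by
  induction hj : u.length using Nat.strong_induction_on generalizing u k d l with
  | _ j ih =>
    have hweight : weight (u.map (Prod.mk 0) ++ [(k, d)]) = k := by
      rw [weight_append, weight_map_zero]
      simp
    have hbullet : bullet f (word (biletter f x) (u.map (Prod.mk 0)) * word (biletter f x) [(k, d)])
        (word (biletter f x) l) ∈ A := by
      rw [← word_append]
      exact hA _ (hlt _ (by omega)) _ (hlt _ (by omega))
    have hlead : bullet f (word (biletter f x) [(k, d)]) (word (biletter f x) l) =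
        word (biletter f x) ((k + 1, d) :: l) := by
      have hcons := ι_mul_bullet f (biletter f x (k, d)) 1 (word (biletter f x) l)
      simpa [biletter_succ] using hcons
    rw [bullet_word_mul, hlead, ← word_append] at hbullet
    refine (A.add_mem_iff_left (A.sum_mem fun i _ => ?_)).1 hbullet
    have hi : i < u.length := i.2.trans_eq (u.length_map (Prod.mk 0))
    have hterm := word_mul_shuffle_mem (x := biletter f x) (A := A)
      (p := (u.take i).map (Prod.mk 0) ++ [(1, u[i])])
      (u := (u.drop (i + 1)).map (Prod.mk 0) ++ [(k, d)]) (v := l) fun s hs => ?_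
    · simpa [biletter_succ, mul_assoc, ← List.map_take, ← List.map_drop] using hterm
    · have hweight : weight s = k + weight l := by
        rw [weight_of_mem_shuffles hs, weight_append, weight_map_zero]
        simp
      rw [List.append_assoc]
      exact ih (u.take i).length (by rw [List.length_take]; omega) (u.take i) 0 u[i] s
        (fun l' hl' => hlt l' (by omega)) rfl

theorem word_biletter_mem (hA : ∀ a ∈ A, ∀ b ∈ A, bullet f a b ∈ A) (hx : words K x ⊆ A)
    (l : List (ℕ × D)) : word (biletter f x) l ∈ A := by
  induction hn : weight l using Nat.strong_induction_on generalizing l with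
  | _ n ih =>
    rcases eq_map_zero_or_exists_succ l with ⟨u, rfl⟩ | ⟨u, k, d, l, rfl⟩
    · exact hx ⟨u, (word_biletter_map_zero f x u).symm⟩
    · refine word_map_zero_append_mem hA u k d l fun l' hl' => ih _ ?_ l' rfl
      simpa [← hn] using hl'

theorem span_words_eq_top (hx : Submodule.span K (Set.range x) = ⊤) :
    Submodule.span K (words K x) = ⊤ := by
  refine eq_top_iff.2 fun a _ => ?_
  induction a using left_induction with
  | h1 => exact Submodule.subset_span ⟨[], word_nil x⟩
  | hadd a b ha hb => exact Submodule.add_mem _ (ha trivial) (hb trivial)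
  | hsmul c a ha => exact Submodule.smul_mem _ c (ha trivial)
  | hmul y a ha =>
    have hy : ι K y ∈ Submodule.span K (ι K '' Set.range x) := by
      rw [← Submodule.map_span, hx]
      exact Submodule.mem_map_of_mem Submodule.mem_top
    have hmul := Submodule.mul_mem_mul hy (ha trivial)
    rw [Submodule.span_mul_span] at hmul
    refine Submodule.span_mono ?_ hmul
    rintro _ ⟨_, ⟨_, ⟨d, rfl⟩, rfl⟩, _, ⟨l, rfl⟩, rfl⟩
    exact ⟨d :: l, word_cons x d l⟩

theorem span_range_biletter (f : V →ₗ[K] V) (x : D → V) :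
    Submodule.span K (Set.range (biletter f x)) =
      ⨆ n : ℕ, (Submodule.span K (Set.range x)).map (f ^ n) := by
  have hrange : Set.range (biletter f x) = ⋃ n : ℕ, (f ^ n) '' Set.range x := by
    ext
    simp [biletter]
  rw [hrange, Submodule.span_iUnion]
  simp only [Submodule.map_span]

theorem preLieAdjoin_words_eq_top
    (hx : ⨆ n : ℕ, (Submodule.span K (Set.range x)).map (f ^ n) = ⊤) :
    preLieAdjoin f (words K x) = ⊤ := by
  refine sInf_eq_top.2 ?_
  rintro A ⟨hwords, hA⟩
  rw [eq_top_iff, ← span_words_eq_top (span_range_biletter f x ▸ hx), Submodule.span_le]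
  rintro _ ⟨l, rfl⟩
  exact word_biletter_mem hA hwords l

theorem comPreLieAdjoin_emptyAndLyndonWords_eq_top [CharZero K] [LinearOrder D]
    (hx : ⨆ n : ℕ, (Submodule.span K (Set.range x)).map (f ^ n) = ⊤) :
    comPreLieAdjoin f (emptyAndLyndonWords K x) = ⊤ := by
  refine sInf_eq_top.2 ?_
  rintro A ⟨hS, hshuffle, hbullet⟩
  rw [eq_top_iff, ← preLieAdjoin_words_eq_top hx]
  refine sInf_le ⟨?_, hbullet⟩
  rintro _ ⟨w, rfl⟩
  exact word_mem_of_emptyAndLyndonWords_subset hS hshuffle w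

end Generation

/-! ### Minimality -/

section Minimality

theorem minimal_eq_top_of_forall_notMem {R M : Type*} [Semiring R] [AddCommMonoid M] [Module R M]
    {F : Set M → Submodule R M} (hF : Monotone F) {S : Set M} (htop : F S = ⊤)
    (hS : ∀ s ∈ S, s ∉ F (S \ {s})) : Minimal (fun T => F T = ⊤) S := by
  refine ⟨htop, fun T hT hTS s hs => by_contra fun hsT => hS s hs ?_⟩
  exact hF (Set.subset_sdiff_singleton hTS hsT) (hT ▸ Submodule.mem_top)

variable {K : Type*} [Field K] {V : Type*} [AddCommGroup V] [Module K V] {D : Type*}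

theorem preLieAdjoin_mono (f : V →ₗ[K] V) : Monotone (preLieAdjoin f) :=
  fun _ _ h => sInf_le_sInf fun _ hA => ⟨h.trans hA.1, hA.2⟩

theorem comPreLieAdjoin_mono (f : V →ₗ[K] V) : Monotone (comPreLieAdjoin f) :=
  fun _ _ h => sInf_le_sInf fun _ hA => ⟨h.trans hA.1, hA.2⟩

section Map

variable {V' : Type*} [AddCommGroup V'] [Module K V'] {f : V →ₗ[K] V} {φ : V →ₗ[K] V'}
  {S : Set (TensorAlgebra K V)} {B : Submodule K (TensorAlgebra K V')}

theorem tensorMap_mem_of_mem_preLieAdjoin (hφ : φ ∘ₗ f = 0) (hS : Set.MapsTo (tensorMap φ) S B)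
    {a : TensorAlgebra K V} (ha : a ∈ preLieAdjoin f S) : tensorMap φ a ∈ B :=
  Submodule.mem_sInf.1 ha (B.comap (tensorMap φ).toLinearMap)
    ⟨hS, fun a _ b _ => by simp [tensorMap_bullet_eq_zero hφ]⟩

theorem tensorMap_mem_of_mem_comPreLieAdjoin (hφ : φ ∘ₗ f = 0)
    (hS : Set.MapsTo (tensorMap φ) S B) (hB : ∀ a ∈ B, ∀ b ∈ B, shuffle a b ∈ B)
    {a : TensorAlgebra K V} (ha : a ∈ comPreLieAdjoin f S) : tensorMap φ a ∈ B :=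
  Submodule.mem_sInf.1 ha (B.comap (tensorMap φ).toLinearMap)
    ⟨hS, fun a ha b hb => by simpa [tensorMap_shuffle] using hB _ ha _ hb,
      fun a _ b _ => by simp [tensorMap_bullet_eq_zero hφ]⟩

end Map

theorem exists_comp_eq_zero_comp_eq_basisSingleOne {f : V →ₗ[K] V} {x : D → V}
    (hx : LinearIndependent K ((LinearMap.range f).mkQ ∘ x)) :
    ∃ φ : V →ₗ[K] D →₀ K, φ ∘ₗ f = 0 ∧ φ ∘ x = Finsupp.basisSingleOne (R := K) := by
  obtain ⟨ψ, hψ⟩ := LinearMap.exists_leftInverse_of_injective _ (linearIndependent_iff_ker.1 hx)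
  refine ⟨ψ ∘ₗ (LinearMap.range f).mkQ, ?_, funext fun d => ?_⟩
  · rw [LinearMap.comp_assoc, LinearMap.range_mkQ_comp, LinearMap.comp_zero]
  · simpa using LinearMap.congr_fun hψ (Finsupp.single d 1)

theorem notMem_preLieAdjoin_words_diff {f : V →ₗ[K] V} {x : D → V}
    (hx : LinearIndependent K ((LinearMap.range f).mkQ ∘ x)) {a : TensorAlgebra K V}
    (ha : a ∈ words K x) : a ∉ preLieAdjoin f (words K x \ {a}) := by
  obtain ⟨φ, hφf, hφx⟩ := exists_comp_eq_zero_comp_eq_basisSingleOne hx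
  have hword (l : List D) : tensorMap φ (word x l) = wordBasis Finsupp.basisSingleOne l := by
    rw [tensorMap_word, hφx, wordBasis_apply]
  obtain ⟨l, rfl⟩ := ha
  intro hmem
  refine (wordBasis (K := K) (D := D) Finsupp.basisSingleOne).linearIndependent.notMem_span_image
    (s := {l}ᶜ) (x := l) (by simp) ?_
  rw [← hword]
  refine tensorMap_mem_of_mem_preLieAdjoin hφf ?_ hmem
  rintro _ ⟨⟨l', rfl⟩, hne⟩
  rw [hword]
  exact Submodule.subset_span (Set.mem_image_of_mem _ fun h => hne (congrArg (word x) h))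

theorem tensorMap_shuffleProd {V' : Type*} [AddCommGroup V'] [Module K V'] (φ : V →ₗ[K] V')
    (x : D → V) (M : Multiset (List D)) :
    tensorMap φ (shuffleProd x M) = shuffleProd (φ ∘ x) M := by
  induction M using Multiset.induction_on with
  | empty => simp
  | cons l M ih => simp [tensorMap_shuffle, tensorMap_word, ih]

theorem shuffle_mem_span_shuffleProd {x : D → V} {T : Set (Multiset (List D))}
    (hT : ∀ M ∈ T, ∀ N ∈ T, M + N ∈ T) {a b : TensorAlgebra K V}
    (ha : a ∈ Submodule.span K (shuffleProd x '' T))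
    (hb : b ∈ Submodule.span K (shuffleProd x '' T)) :
    shuffle a b ∈ Submodule.span K (shuffleProd x '' T) := by
  have hab := Submodule.apply_mem_map₂ shuffle ha hb
  rw [Submodule.map₂_span_span] at hab
  refine Submodule.span_mono ?_ hab
  rintro _ ⟨_, ⟨M, hM, rfl⟩, _, ⟨N, hN, rfl⟩, rfl⟩
  exact ⟨M + N, hT M hM N hN, shuffleProd_add x M N⟩

theorem eq_or_eq_of_card_add_le_one {α : Type*} {M N : Multiset α} (h : (M + N).card ≤ 1) :
    M = M + N ∨ N = M + N := by
  rw [Multiset.card_add] at h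
  rcases (by omega : M.card = 0 ∨ N.card = 0) with h | h <;>
    simp [Multiset.card_eq_zero.1 h]

theorem notMem_comPreLieAdjoin_emptyAndLyndonWords_diff [CharZero K] [LinearOrder D]
    {f : V →ₗ[K] V} {x : D → V} (hx : LinearIndependent K ((LinearMap.range f).mkQ ∘ x))
    {a : TensorAlgebra K V} (ha : a ∈ emptyAndLyndonWords K x) :
    a ∉ comPreLieAdjoin f (emptyAndLyndonWords K x \ {a}) := by
  obtain ⟨φ, hφf, hφx⟩ := exists_comp_eq_zero_comp_eq_basisSingleOne hx
  rw [emptyAndLyndonWords_eq] at ha ⊢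
  obtain ⟨M, ⟨hcard, hM⟩, rfl⟩ := ha
  intro hmem
  refine (linearIndepOn_shuffleProd (K := K) (D := D) Finsupp.basisSingleOne).notMem_span hM ?_
  rw [← hφx, ← tensorMap_shuffleProd]
  refine tensorMap_mem_of_mem_comPreLieAdjoin hφf ?_ ?_ hmem
  · rintro _ ⟨⟨N, ⟨-, hN⟩, rfl⟩, hne⟩
    rw [tensorMap_shuffleProd]
    exact Submodule.subset_span ⟨N, ⟨hN, fun h => hne (congrArg (shuffleProd x) h)⟩, rfl⟩
  · refine fun a ha b hb => shuffle_mem_span_shuffleProd ?_ ha hb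
    rintro N ⟨hN, hNM⟩ N' ⟨hN', hN'M⟩
    refine ⟨fun l hl => (Multiset.mem_add.1 hl).elim (hN l) (hN' l), ?_⟩
    rintro rfl
    exact (eq_or_eq_of_card_add_le_one hcard).elim hNM hN'M

theorem minimal_preLieAdjoin_words {f : V →ₗ[K] V} {x : D → V}
    (hgen : ⨆ n : ℕ, (Submodule.span K (Set.range x)).map (f ^ n) = ⊤)
    (hx : LinearIndependent K ((LinearMap.range f).mkQ ∘ x)) :
    Minimal (fun S => preLieAdjoin f S = ⊤) (words K x) :=
  minimal_eq_top_of_forall_notMem (preLieAdjoin_mono f) (preLieAdjoin_words_eq_top hgen)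
    fun _ => notMem_preLieAdjoin_words_diff hx

theorem minimal_comPreLieAdjoin_emptyAndLyndonWords [CharZero K] [LinearOrder D] {f : V →ₗ[K] V}
    {x : D → V} (hgen : ⨆ n : ℕ, (Submodule.span K (Set.range x)).map (f ^ n) = ⊤)
    (hx : LinearIndependent K ((LinearMap.range f).mkQ ∘ x)) :
    Minimal (fun S => comPreLieAdjoin f S = ⊤) (emptyAndLyndonWords K x) :=
  minimal_eq_top_of_forall_notMem (comPreLieAdjoin_mono f)
    (comPreLieAdjoin_emptyAndLyndonWords_eq_top hgen)
    fun _ => notMem_comPreLieAdjoin_emptyAndLyndonWords_diff hx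

end Minimality

/-! ### Biletters -/

section Biletters

variable (K : Type*) [Field K] (D : Type*)

theorem biletter_biShift_biletterZero (p : ℕ × D) :
    biletter (biShift K D) (biletterZero K) p = Finsupp.single p 1 := by
  obtain ⟨k, d⟩ := p
  induction k with
  | zero => simp [biletter, biletterZero]
  | succ k ih => rw [biletter_succ, ih, biShift, Finsupp.lmapDomain_apply, Finsupp.mapDomain_single]

theorem iSup_map_biShift_pow_eq_top :
    ⨆ n : ℕ, (Submodule.span K (Set.range (biletterZero K (D := D)))).map (biShift K D ^ n) =
      ⊤ := by
  rw [← span_range_biletter, funext (biletter_biShift_biletterZero K D),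
    ← Finsupp.coe_basisSingleOne, Module.Basis.span_eq]

theorem linearIndependent_mkQ_comp_biletterZero :
    LinearIndependent K ((LinearMap.range (biShift K D)).mkQ ∘ biletterZero K) := by
  let π : BiSpace K D →ₗ[K] D →₀ K :=
    Finsupp.lcomapDomain (Prod.mk 0) (Prod.mk_right_injective 0)
  have hπ : LinearMap.range (biShift K D) ≤ LinearMap.ker π := by
    rw [LinearMap.range_le_ker_iff]
    ext ⟨k, d⟩ e
    simp [π, biShift]
  refine .of_comp ((LinearMap.range (biShift K D)).liftQ π hπ) ?_
  have hπx : (LinearMap.range (biShift K D)).liftQ π hπ ∘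
      (LinearMap.range (biShift K D)).mkQ ∘ biletterZero K = Finsupp.basisSingleOne := by
    ext
    simp [π, biletterZero]
  rw [hπx]
  exact Finsupp.basisSingleOne.linearIndependent

variable {K} {V : Type*} [AddCommGroup V] [Module K V]

theorem words_coe_subset_tensorSubspace (W : Submodule K V) :
    words K ((↑) : W → V) ⊆ tensorSubspace W := by
  rintro _ ⟨l, rfl⟩
  exact ⟨word id l, tensorMap_word id W.subtype l⟩

end Biletters

end ComPreLie

end

open ComPreLie in
theorem mainTheorem6_general {K : Type*} [Field K] {V : Type*} [AddCommGroup V] [Module K V]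
    (f : V →ₗ[K] V) {D : Type*} (x : D → V)
    (hgen : ⨆ n : ℕ, (Submodule.span K (Set.range x)).map (f ^ n) = ⊤) :
    (preLieAdjoin f (words K x) = ⊤ ∧
      (LinearIndependent K ((LinearMap.range f).mkQ ∘ x) →
        Minimal (fun S => preLieAdjoin f S = ⊤) (words K x))) ∧
    ∀ [CharZero K] [LinearOrder D],
      comPreLieAdjoin f (emptyAndLyndonWords K x) = ⊤ ∧
      (LinearIndependent K ((LinearMap.range f).mkQ ∘ x) →
        Minimal (fun S => comPreLieAdjoin f S = ⊤) (emptyAndLyndonWords K x)) :=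
  ⟨⟨preLieAdjoin_words_eq_top hgen, minimal_preLieAdjoin_words hgen⟩,
    comPreLieAdjoin_emptyAndLyndonWords_eq_top hgen,
    minimal_comPreLieAdjoin_emptyAndLyndonWords hgen⟩

theorem mainTheorem6 {K : Type*} [Field K] [CharZero K] :
    (∀ (D : Type*) [LinearOrder D],
      Minimal (fun S => ComPreLie.preLieAdjoin (ComPreLie.biShift K D) S = ⊤)
        (ComPreLie.words K (ComPreLie.biletterZero K (D := D))) ∧
      Minimal (fun S => ComPreLie.comPreLieAdjoin (ComPreLie.biShift K D) S = ⊤)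
        (ComPreLie.emptyAndLyndonWords K (ComPreLie.biletterZero K (D := D)))) ∧
    (∀ (V : Type*) [AddCommGroup V] [Module K V] (g : V →ₗ[K] V) (W : Submodule K V),
      (⨆ n : ℕ, W.map (g ^ n)) = ⊤ →
        ComPreLie.preLieAdjoin g (ComPreLie.tensorSubspace W) = ⊤ ∧
        ∀ (D : Type*) [LinearOrder D] (w : Module.Basis D K W),
          ComPreLie.comPreLieAdjoin g
            (ComPreLie.emptyAndLyndonWords K fun d => (w d : V)) = ⊤) := by
  refine ⟨fun D _ => ?_, fun V _ _ g W hW => ⟨?_, fun D _ w => ?_⟩⟩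
  · have hgen := ComPreLie.iSup_map_biShift_pow_eq_top K D
    have hind := ComPreLie.linearIndependent_mkQ_comp_biletterZero K D
    have hminimal := mainTheorem6_general _ _ hgen
    exact ⟨hminimal.1.2 hind, hminimal.2.2 hind⟩
  · have hspan : Submodule.span K (Set.range ((↑) : W → V)) = W := by simp
    have hwords := (mainTheorem6_general g _ (hspan.symm ▸ hW)).1.1
    exact top_le_iff.1 (hwords.symm.trans_le
      (ComPreLie.preLieAdjoin_mono g (ComPreLie.words_coe_subset_tensorSubspace W)))
  · have hspan : Submodule.span K (Set.range fun d => (w d : V)) = W := by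
      rw [Set.range_comp' Subtype.val w, ← W.coe_subtype, Submodule.span_image, w.span_eq,
        Submodule.map_subtype_top]
    exact (mainTheorem6_general g _ (hspan.symm ▸ hW)).2.1
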